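/- **Theorem (a.e. Uniform Convergence Theorem for the Sion Integral).** *Conventions.* In a Riesz space, $u_n\downarrow 0$ means that $(u_n)$ is non-increasing with $\inf_n u_n=0$. A sequence $x_n$ order-converges to $x$ ($x_n\xrightarrow{o}x$) if there is $w_n\downarrow 0$ with $|x_n-x|\le w_n$ for all $n$. A *regulator* is a bounded double sequence $(a_{ij})_{i,j\in\mathbb N}$ with $a_{ij}\downarrow 0$ ($j\to\infty$) for each $i$. A net $(z_\gamma)$ is *$(D)$-convergent* to $z$ if there is a regulator $(a_{ij})$ such that for every $\varphi\in\mathbb N^{\mathbb N}$ there is $\gamma_0$ with $|z_\gamma-z|\le\bigvee_i a_{i\varphi(i)}$ for all $\gamma\ge\gamma_0$. A Dedekind complete Riesz space is *weakly $\sigma$-distributive* if $\bigwedge_{\varphi\in\mathbb N^{\mathbb N}}\bigvee_i a_{i\varphi(i)}=0$ for every regulator. A *Boccuto–Candeloro net convergence structure* $\eta$ on a Riesz space specifies which nets converge to which points, subject to: (i) if $x_i\to x$ and $y_j\to y$ then $(x_i+y_j)_{(i,j)}\to x+y$; and if $x_i\to x$, $y_i\to y$ and $x_i\le y_i$ on a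 cofinal set of indices, then $x\le y$; (ii) $x_i\to x$ implies $|x_i|\to|x|$; (iii) if $x_i\to x$, $y_i\to x$ and eventually $x_i\le z_i\le y_i$, then $z_i\to x$; (iv) if a sequence $(x_n)$ converges, then $\frac1n x_n\to 0$; (v) constant nets converge to their value; (vi) if $x_i\to x$ and every tail of $(x_i)$ contains a tail of $(y_j)$, then $y_j\to x$; (vii) if $x_i\to x$, $y_i\to x$ and $z_i\in\{x_i,y_i\}$ for all $i$, then $z_i\to x$. *Setting.* Let $X,Y,Z$ be Riesz spaces, $Z$ Dedekind complete and weakly $\sigma$-distributive and equipped with $(D)$-convergence. Let $X,Y$ carry Boccuto–Candeloro net convergence structures $\eta_1,\eta_2$ such that $u_n\downarrow0$ in $X$ implies $u_n\to0$ in $\eta_1$ (for example, order convergence). Let $X\times Y\to Z$, $(x,y)\mapsto xy$, be bilinear, isotone on the positive cones, and continuous in each argument for these convergences. Let $\Omega$ be a set, $\mathcal H$ an algebra of subsets of $\Omega$ (with $\Omega\in\mathcal H$), and $\mu:\mathcal H\to Y^+$ a set function. *Sion (partition) integral.* Let $\mathcal P$ be the set of countable partitions of $\Omega$ into nonempty members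 of $\mathcal H$. A truncation $\Delta$ assigns to each $P\in\mathcal P$ a finite subset $\Delta(P)\subseteq P$. Let $\Gamma$ be the set of triples $\gamma=(P,\tau,\Delta)$ with $P\in\mathcal P$, $\tau=(\tau_\sigma)_{\sigma\in P}$, $\tau_\sigma\in\sigma$, and $\Delta$ a truncation. It is directed by: $(P,\tau,\Delta)\le(Q,\tau',\Delta')$ iff $Q$ refines $P$ and $\Delta(M)\subseteq\Delta'(M)$ for every $M\in\mathcal P$ refining $Q$. A function $f:\Omega\to X$ is *Sion integrable* with integral $\int^{Si}_\Omega f\,d\mu\in Z$ if the net of Riemann sums $\sum_{\sigma\in\Delta(P)}f(\tau_\sigma)\mu(\sigma)$, $\gamma\in\Gamma$, $(D)$-converges to it. Call $\mu$ a *regular integrator* if for every $A\in\mathcal H$ the net $\sum_{\sigma\in\Delta(P)}\mathbb 1_A(\tau_\sigma)\mu(\sigma)$, $\gamma\in\Gamma$, converges in $\eta_2$ to $\mu(A)$. *Statement.* Let $\mu$ be a regular integrator, let $f_n:\Omega\to X$ ($n\in\mathbb N$) be Sion integrable, and let $f:\Omega\to X$. Suppose that $f_n\to f$ order-uniformly almost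 everywhere: there are $N\in\mathcal H$ with $\mu(N)=0$ and a sequence $u_n\downarrow0$ in $X$ with $|f_n(t)-f(t)|\le u_n$ for all $n$ and all $t\in\Omega\setminus N$. Then $f$ is Sion integrable and $$\int^{Si}_\Omega f_n\,d\mu\xrightarrow{o}\int^{Si}_\Omega f\,d\mu .$$ -/

import Mathlib

open Set

universe u v w

/-! ### Order-theoretic notions -/

/-- The sequence `u` decreases to `0`: it is non-increasing with infimum `0`. -/
def DecreasesToZero {X : Type v} [Preorder X] [Zero X] (u : ℕ → X) : Prop :=
  Antitone u ∧ IsGLB (range u) 0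

/-- Order convergence of a sequence in a Riesz space. -/
def SeqOrderConverges {X : Type v} [Lattice X] [AddCommGroup X] (x : ℕ → X) (l : X) : Prop :=
  ∃ w : ℕ → X, DecreasesToZero w ∧ ∀ n, |x n - l| ≤ w n

/-- A `(D)`-sequence (regulator): a bounded double sequence `a i j` which, for each fixed `i`,
decreases to `0` as `j` grows. -/
def IsDSequence {X : Type v} [Preorder X] [Zero X] (a : ℕ → ℕ → X) : Prop :=
  (∀ i, DecreasesToZero (a i)) ∧ ∃ b, ∀ i j, a i j ≤ b

/-- Weak `σ`-distributivity: for every regulator `a`, the infimum over `φ : ℕ → ℕ` of the suprema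
`⋁ i, a i (φ i)` is `0`. -/
def WeaklySigmaDistributive (X : Type v) [Preorder X] [Zero X] : Prop :=
  ∀ a : ℕ → ℕ → X, IsDSequence a →
    IsGLB {s : X | ∃ φ : ℕ → ℕ, IsLUB (range fun i => a i (φ i)) s} 0

/-! ### Net convergence structures -/

/-- A relation "the net `x : I → X` converges to `a`", for nets indexed by preordered sets
(it is only ever used for nonempty directed index sets). -/
abbrev NetConv (X : Type v) : Type (max (u + 1) v) :=
  ∀ (I : Type u) [Preorder I], (I → X) → X → Prop

/-- `y` is a quasi-subnet of `x`: every tail of `x` contains a tail of `y`. -/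
def IsQuasiSubnet {X : Type v} {I J : Type u} [Preorder I] [Preorder J]
    (y : J → X) (x : I → X) : Prop :=
  ∀ i₀ : I, ∃ j₀ : J, ∀ j, j₀ ≤ j → ∃ i, i₀ ≤ i ∧ y j = x i

/-- The axioms of a Boccuto-Candeloro net convergence structure on a Riesz space.
The index set of a sequence is `ℕ`, lifted to the universe of index sets. -/
structure IsBoccutoCandeloro {X : Type v} [Lattice X] [AddCommGroup X] [Module ℝ X]
    (η : NetConv.{u} X) : Prop where
  add : ∀ {I J : Type u} [Preorder I] [IsDirectedOrder I] [Nonempty I]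
    [Preorder J] [IsDirectedOrder J] [Nonempty J] (x : I → X) (y : J → X) (a b : X),
    η I x a → η J y b → η (I × J) (fun p => x p.1 + y p.2) (a + b)
  /-- It suffices that `x i ≤ y i` on a cofinal set of indices. -/
  le : ∀ {I : Type u} [Preorder I] [IsDirectedOrder I] [Nonempty I] (x y : I → X) (a b : X),
    η I x a → η I y b → (∀ i, ∃ j, i ≤ j ∧ x j ≤ y j) → a ≤ b
  abs : ∀ {I : Type u} [Preorder I] [IsDirectedOrder I] [Nonempty I] (x : I → X) (a : X),
    η I x a → η I (fun i => |x i|) |a|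
  squeeze : ∀ {I : Type u} [Preorder I] [IsDirectedOrder I] [Nonempty I]
    (x y z : I → X) (a : X), η I x a → η I y a →
    (∃ i₀, ∀ i, i₀ ≤ i → x i ≤ z i ∧ z i ≤ y i) → η I z a
  /-- If a sequence `x₁, x₂, …` converges then `(1 / n) xₙ` converges to `0`. -/
  inv_smul : ∀ (x : ULift.{u} ℕ → X) (a : X), η (ULift.{u} ℕ) x a →
    η (ULift.{u} ℕ) (fun n => (1 / ((n.down : ℝ) + 1)) • x n) 0
  const : ∀ {I : Type u} [Preorder I] [IsDirectedOrder I] [Nonempty I] (a : X),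
    η I (fun _ => a) a
  quasiSubnet : ∀ {I J : Type u} [Preorder I] [IsDirectedOrder I] [Nonempty I]
    [Preorder J] [IsDirectedOrder J] [Nonempty J] (x : I → X) (y : J → X) (a : X),
    η I x a → IsQuasiSubnet y x → η J y a
  mix : ∀ {I : Type u} [Preorder I] [IsDirectedOrder I] [Nonempty I]
    (x y z : I → X) (a : X), η I x a → η I y a → (∀ i, z i = x i ∨ z i = y i) → η I z a

/-- `(D)`-convergence of nets: there is a regulator `a` such that for every `φ : ℕ → ℕ` the
inequality `|x i - l| ≤ ⋁ j, a j (φ j)` holds for all `i` from some index on. -/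
def DConv (X : Type v) [Lattice X] [AddCommGroup X] : NetConv.{u} X :=
  fun I _ x l => ∃ a : ℕ → ℕ → X, IsDSequence a ∧ ∀ φ : ℕ → ℕ,
    ∃ s, IsLUB (range fun j => a j (φ j)) s ∧ ∃ i₀ : I, ∀ i, i₀ ≤ i → |x i - l| ≤ s

/-- Continuity of a map with respect to net convergence structures. -/
def NetContinuous {X : Type v} {Y : Type w} (η : NetConv.{u} X) (θ : NetConv.{u} Y)
    (g : X → Y) : Prop :=
  ∀ {I : Type u} [Preorder I] [IsDirectedOrder I] [Nonempty I] (x : I → X) (a : X),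
    η I x a → θ I (fun i => g (x i)) (g a)

/-- A product of Riesz spaces with convergence structures: a bilinear map which is isotone on the
positive cones and continuous in each argument. -/
structure IsRieszProduct {X Y Z : Type*}
    [Lattice X] [AddCommGroup X] [Module ℝ X] [Lattice Y] [AddCommGroup Y] [Module ℝ Y]
    [Lattice Z] [AddCommGroup Z] [Module ℝ Z]
    (η₁ : NetConv.{u} X) (η₂ : NetConv.{u} Y) (η₃ : NetConv.{u} Z)
    (B : X →ₗ[ℝ] Y →ₗ[ℝ] Z) : Prop where
  isotone : ∀ x x' : X, ∀ y y' : Y, 0 ≤ x → x ≤ x' → 0 ≤ y → y ≤ y' → B x y ≤ B x' y'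
  continuous_left : ∀ y : Y, NetContinuous η₁ η₃ (fun x => B x y)
  continuous_right : ∀ x : X, NetContinuous η₂ η₃ (fun y => B x y)

/-! ### The Sion integral -/

/-- A countable partition of `Ω` into nonempty sets belonging to `H`. -/
structure CountablePartition {Ω : Type u} (H : Set (Set Ω)) where
  parts : Set (Set Ω)
  countable : parts.Countable
  subset : parts ⊆ H
  nonempty : ∀ σ ∈ parts, σ.Nonempty
  disjoint : parts.PairwiseDisjoint id
  cover : ⋃₀ parts = univ

/-- `Q` refines `P`. -/
def CountablePartition.Refines {Ω : Type u} {H : Set (Set Ω)} (Q P : CountablePartition H) :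
    Prop :=
  ∀ β ∈ Q.parts, ∃ α ∈ P.parts, β ⊆ α

/-- A truncation assigns to every countable partition a finite set of its members. -/
structure Truncation {Ω : Type u} (H : Set (Set Ω)) where
  toFun : CountablePartition H → Finset (Set Ω)
  mem_parts : ∀ P, ∀ σ ∈ toFun P, σ ∈ P.parts

/-- The index set of the Sion net: a countable partition, a choice of a point in each of its
members, and a truncation. -/
structure SionIndex {Ω : Type u} (H : Set (Set Ω)) where
  partition : CountablePartition H
  point : partition.parts → Ω
  point_mem : ∀ σ, point σ ∈ σ.1
  truncation : Truncation H

/-- `γ ≤ γ'` if the partition of `γ'` refines that of `γ` and, on all partitions that refine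
the one of `γ'`, the truncation of `γ'` contains that of `γ`. The chosen points play no role. -/
instance SionIndex.instPreorder {Ω : Type u} (H : Set (Set Ω)) : Preorder (SionIndex H) where
  le γ γ' := γ'.partition.Refines γ.partition ∧
    ∀ M : CountablePartition H, M.Refines γ'.partition →
      γ.truncation.toFun M ⊆ γ'.truncation.toFun M
  le_refl _ := ⟨fun β hβ => ⟨β, hβ, subset_rfl⟩, fun _ _ => subset_rfl⟩
  le_trans _ _ _ h h' := by
    have tr : ∀ {P Q R : CountablePartition H}, R.Refines Q → Q.Refines P → R.Refines P := by
      intro P Q R h₁ h₂ β hβ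
      obtain ⟨α, hα, hβα⟩ := h₁ β hβ
      obtain ⟨ε, hε, hαε⟩ := h₂ α hα
      exact ⟨ε, hε, hβα.trans hαε⟩
    exact ⟨tr h'.1 h.1, fun M hM => (h.2 M (tr hM h'.1)).trans (h'.2 M hM)⟩

/-- Over an algebra of sets the index set of the Sion net is directed. -/
theorem SionIndex.isDirectedOrder {Ω : Type u} {H : Set (Set Ω)}
    (hH : MeasureTheory.IsSetAlgebra H) : IsDirectedOrder (SionIndex H) := by
  classical
  constructor
  intro γ γ'
  let R : CountablePartition H :=
    { parts := (image2 (· ∩ ·) γ.partition.parts γ'.partition.parts) \ {∅}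
      countable := (γ.partition.countable.image2 γ'.partition.countable _).mono sdiff_subset
      subset := by
        rintro _ ⟨⟨α, hα, β, hβ, rfl⟩, -⟩
        exact hH.inter_mem (γ.partition.subset hα) (γ'.partition.subset hβ)
      nonempty := fun σ hσ => nonempty_iff_ne_empty.2 hσ.2
      disjoint := by
        rintro _ ⟨⟨α, hα, β, hβ, rfl⟩, -⟩ _ ⟨⟨α', hα', β', hβ', rfl⟩, -⟩ hne
        by_cases h : α = α'
        · subst h
          have hb : β ≠ β' := fun h => hne (by rw [h])
          exact (γ'.partition.disjoint hβ hβ' hb).mono inter_subset_right inter_subset_right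
        · exact (γ.partition.disjoint hα hα' h).mono inter_subset_left inter_subset_left
      cover := by
        refine eq_univ_of_forall fun t => ?_
        obtain ⟨α, hα, hα'⟩ : t ∈ ⋃₀ γ.partition.parts := by rw [γ.partition.cover]; trivial
        obtain ⟨β, hβ, hβ'⟩ : t ∈ ⋃₀ γ'.partition.parts := by rw [γ'.partition.cover]; trivial
        exact ⟨α ∩ β, ⟨⟨α, hα, β, hβ, rfl⟩, nonempty_iff_ne_empty.1 ⟨t, hα', hβ'⟩⟩,
          hα', hβ'⟩ }
  refine ⟨⟨R, fun σ => (R.nonempty σ.1 σ.2).some, fun σ => (R.nonempty σ.1 σ.2).some_mem,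
    ⟨fun M => γ.truncation.toFun M ∪ γ'.truncation.toFun M, fun P σ hσ =>
      (Finset.mem_union.1 hσ).elim (γ.truncation.mem_parts P σ) (γ'.truncation.mem_parts P σ)⟩⟩,
    ⟨?_, fun M _ => Finset.subset_union_left⟩, ⟨?_, fun M _ => Finset.subset_union_right⟩⟩
  · rintro _ ⟨⟨α, hα, β, hβ, rfl⟩, -⟩
    exact ⟨α, hα, inter_subset_left⟩
  · rintro _ ⟨⟨α, hα, β, hβ, rfl⟩, -⟩
    exact ⟨β, hβ, inter_subset_right⟩

/-- The Riemann sum `∑ f(τ_σ) μ(σ)` over the members `σ` of the partition selected by the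
truncation; the product is the bilinear map `B`. -/
noncomputable def SionIndex.riemannSum {Ω : Type u} {H : Set (Set Ω)} {X Y Z : Type*}
    [AddCommGroup X] [Module ℝ X] [AddCommGroup Y] [Module ℝ Y] [AddCommGroup Z] [Module ℝ Z]
    (γ : SionIndex H) (B : X →ₗ[ℝ] Y →ₗ[ℝ] Z) (f : Ω → X) (μ : Set Ω → Y) : Z :=
  ∑ σ ∈ (γ.truncation.toFun γ.partition).attach,
    B (f (γ.point ⟨σ.1, γ.truncation.mem_parts γ.partition σ.1 σ.2⟩)) (μ σ.1)

/-- `f` is Sion (partition) integrable on `Ω` with integral `l`, for the convergence structure `η`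
on the space `Z` of values of the integral. -/
def HasSionIntegral {Ω : Type u} (H : Set (Set Ω)) {X Y Z : Type*}
    [AddCommGroup X] [Module ℝ X] [AddCommGroup Y] [Module ℝ Y] [AddCommGroup Z] [Module ℝ Z]
    (η : NetConv.{u} Z) (B : X →ₗ[ℝ] Y →ₗ[ℝ] Z) (μ : Set Ω → Y) (f : Ω → X) (l : Z) : Prop :=
  η (SionIndex H) (fun γ => γ.riemannSum B f μ) l

/-- `f` is Sion (partition) integrable on `Ω`. -/
def SionIntegrable {Ω : Type u} (H : Set (Set Ω)) {X Y Z : Type*}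
    [AddCommGroup X] [Module ℝ X] [AddCommGroup Y] [Module ℝ Y] [AddCommGroup Z] [Module ℝ Z]
    (η : NetConv.{u} Z) (B : X →ₗ[ℝ] Y →ₗ[ℝ] Z) (μ : Set Ω → Y) (f : Ω → X) : Prop :=
  ∃ l, HasSionIntegral H η B μ f l

/-- `μ` is a regular integrator: the integral of the real-valued indicator of each `A ∈ H`,
formed with the scalar product `ℝ × Y → Y`, is `μ A`. -/
def IsRegularIntegrator {Ω : Type u} (H : Set (Set Ω)) {Y : Type*} [AddCommGroup Y] [Module ℝ Y]
    (η : NetConv.{u} Y) (μ : Set Ω → Y) : Prop :=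
  ∀ A ∈ H, HasSionIntegral H η (LinearMap.lsmul ℝ Y) μ (A.indicator fun _ => (1 : ℝ)) (μ A)

/-- `f n` converges to `f` order-uniformly outside some `μ`-null set `N ∈ H`. -/
def ConvergesOrderUniformlyAE {Ω : Type u} (H : Set (Set Ω)) {X Y : Type*}
    [Lattice X] [AddCommGroup X] [Zero Y] (μ : Set Ω → Y) (f : ℕ → Ω → X) (g : Ω → X) : Prop :=
  ∃ N ∈ H, μ N = 0 ∧ ∃ u : ℕ → X, DecreasesToZero u ∧
    ∀ n, ∀ t ∉ N, |f n t - g t| ≤ u n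

/-! ### `(D)`-convergence -/

/-! Regularity replaces additivity of `μ`: finite sums of indicators of disjoint subsets of `A` lie
below the indicator of `A`, and passing to the limit gives `∑ μ σ ≤ μ A`
(`IsRegularIntegrator.sum_le`). Hence subsets of `N` in `H` are null, and over partitions refining
`{N, Nᶜ}` the Riemann sums of `f n` and `g` differ by at most `w n = B (u n) (μ univ)`
(`SionIndex.abs_riemannSum_sub_le`). Continuity of the product and weak `σ`-distributivity give `w n
↓ 0`. The rest is an exchange of limits: `DConv.exists_of_uniform_approx` merges countably many
regulators into one to integrate `g`, and `DConv.abs_sub_le` carries the bound `w n` over to the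
integrals. -/

theorem DecreasesToZero.nonneg {X : Type v} [Preorder X] [Zero X] {u : ℕ → X}
    (hu : DecreasesToZero u) (n : ℕ) : 0 ≤ u n :=
  hu.2.1 (mem_range_self n)

theorem WeaklySigmaDistributive.le_zero {Z : Type v} [Preorder Z] [Zero Z]
    (hZ : WeaklySigmaDistributive Z) {a : ℕ → ℕ → Z} (ha : IsDSequence a) {b : Z}
    (h : ∀ (φ : ℕ → ℕ) (s : Z), IsLUB (range fun i => a i (φ i)) s → b ≤ s) : b ≤ 0 :=
  (hZ a ha).2 fun s ⟨φ, hs⟩ => h φ s hs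

/-- If two nets differ by at most `w` from some index on, so do their `(D)`-limits. -/
theorem DConv.abs_sub_le {Z : Type v} [Lattice Z] [AddCommGroup Z] [IsOrderedAddMonoid Z]
    (hZ : WeaklySigmaDistributive Z) {I : Type u} [Preorder I] [IsDirectedOrder I]
    {x y : I → Z} {a b w : Z} (hx : DConv Z I x a) (hy : DConv Z I y b)
    (h : ∃ i₀, ∀ i, i₀ ≤ i → |x i - y i| ≤ w) : |a - b| ≤ w := by
  obtain ⟨c, hc, hcx⟩ := hx
  obtain ⟨d, hd, hdy⟩ := hy
  obtain ⟨k, hk⟩ := h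
  -- Distributivity is used once per regulator, with `φ` frozen while `ψ` varies, so the two
  -- regulators need not be combined.
  have key : |a - b| - w ≤ 0 := by
    refine hZ.le_zero hc fun φ s hs => ?_
    have : |a - b| - w - s ≤ 0 := by
      refine hZ.le_zero hd fun ψ t ht => ?_
      obtain ⟨s', hs', i₁, h₁⟩ := hcx φ
      obtain ⟨t', ht', i₂, h₂⟩ := hdy ψ
      rw [hs'.unique hs] at h₁
      rw [ht'.unique ht] at h₂
      obtain ⟨m, hm₁, hm₂⟩ := exists_ge_ge i₁ i₂
      obtain ⟨i, hi₁, hi₂⟩ := exists_ge_ge m k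
      have e : a - b = -(x i - a) + (x i - y i) + (y i - b) := by abel
      have h3 : |a - b| ≤ s + w + t := by
        rw [e]
        refine (abs_add_le _ _).trans (add_le_add ((abs_add_le _ _).trans ?_)
          (h₂ i (hm₂.trans hi₁)))
        rw [abs_neg]
        exact add_le_add (h₁ i (hm₁.trans hi₁)) (hk i hi₂)
      rw [sub_sub, sub_le_iff_le_add, add_comm w]
      exact h3.trans_eq (add_comm _ _)
    exact sub_nonpos.1 this
  exact sub_nonpos.1 key

/-- An antitone sequence of positive elements that `(D)`-converges to `0` has infimum `0`. -/
theorem DConv.decreasesToZero {Z : Type v} [Lattice Z] [AddCommGroup Z]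
    (hZ : WeaklySigmaDistributive Z) {w : ℕ → Z} (hw : Antitone w) (hw0 : ∀ n, 0 ≤ w n)
    (h : DConv.{u} Z (ULift.{u} ℕ) (fun n => w n.down) 0) : DecreasesToZero w := by
  refine ⟨hw, forall_mem_range.2 hw0, fun b hb => ?_⟩
  obtain ⟨a, ha, h⟩ := h
  refine hZ.le_zero ha fun φ s hs => ?_
  obtain ⟨s', hs', n, hn⟩ := h φ
  have := hn n le_rfl
  rw [sub_zero, hs'.unique hs] at this
  exact (hb (mem_range_self n.down)).trans ((le_abs_self _).trans this)

/-- The lattice operation `M ⊓ ·` distributes over suprema in a lattice ordered group. -/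
theorem IsLUB.inf_le_of_forall_inf_le {Z : Type v} [Lattice Z] [AddCommGroup Z]
    [IsOrderedAddMonoid Z] {ι : Type*} {a : ι → Z} {s M S : Z} (hs : IsLUB (range a) s)
    (h : ∀ i, M ⊓ a i ≤ S) : M ⊓ s ≤ S := by
  -- The identity `M ⊓ z + M ⊔ z = M + z` turns a bound on `M ⊓ a i` into one on `a i` itself, to
  -- which the supremum applies.
  have h1 : s ≤ S + M ⊔ s - M := by
    refine hs.2 (forall_mem_range.2 fun i => ?_)
    have e := inf_add_sup M (a i)
    have h2 : M ⊔ a i ≤ M ⊔ s := sup_le_sup_left (hs.1 (mem_range_self i)) _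
    have h3 := add_le_add (h i) h2
    rw [e] at h3
    exact le_sub_iff_add_le'.2 h3
  have e := inf_add_sup M s
  have h2 := le_sub_iff_add_le'.1 h1
  rw [← e] at h2
  exact le_of_add_le_add_right h2

/-- A `(D)`-convergent net is eventually within some fixed element of its limit. -/
theorem DConv.exists_bound {Z : Type v} [Lattice Z] [AddCommGroup Z] {I : Type u} [Preorder I]
    {x : I → Z} {a : Z} (hx : DConv Z I x a) : ∃ M, ∃ i₀, ∀ i, i₀ ≤ i → |x i - a| ≤ M := by
  obtain ⟨c, -, h⟩ := hx
  obtain ⟨s, -, hs⟩ := h 0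
  exact ⟨s, hs⟩

theorem DecreasesToZero.const_smul {Z : Type v} [Lattice Z] [AddCommGroup Z] [IsOrderedAddMonoid Z]
    [Module ℝ Z] [IsOrderedModule ℝ Z] {u : ℕ → Z} (hu : DecreasesToZero u) {c : ℝ} (hc : 0 < c) :
    DecreasesToZero fun n => c • u n := by
  refine ⟨fun m n h => smul_le_smul_of_nonneg_left (hu.1 h) hc.le,
    forall_mem_range.2 fun n => smul_nonneg hc.le (hu.nonneg n), fun b hb => ?_⟩
  have : c⁻¹ • b ≤ 0 := hu.2.2 <| forall_mem_range.2 fun n =>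
    (inv_smul_le_iff_of_pos hc).2 (hb (mem_range_self n))
  simpa using (inv_smul_le_iff_of_pos hc).1 this

theorem DecreasesToZero.const_inf {Z : Type v} [Lattice Z] [Zero Z] {u : ℕ → Z}
    (hu : DecreasesToZero u) {M : Z} (hM : 0 ≤ M) : DecreasesToZero fun n => M ⊓ u n :=
  ⟨fun _ _ h => inf_le_inf_left _ (hu.1 h), forall_mem_range.2 fun n => le_inf hM (hu.nonneg n),
    fun _ hb => hu.2.2 <| forall_mem_range.2 fun n => (hb (mem_range_self n)).trans inf_le_right⟩

/-- Uniform approximation of a net by `(D)`-convergent nets yields `(D)`-convergence. The regulators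
of the approximants are truncated by a common bound and combined into one, whose first row controls
the choice of the approximant. -/
theorem DConv.exists_of_uniform_approx {Z : Type v} [ConditionallyCompleteLattice Z]
    [AddCommGroup Z] [IsOrderedAddMonoid Z] [Module ℝ Z] [IsOrderedModule ℝ Z]
    (hZ : WeaklySigmaDistributive Z) {I : Type u} [Preorder I] [IsDirectedOrder I]
    {x : ℕ → I → Z} {y : I → Z} {w a : ℕ → Z} (hw : DecreasesToZero w)
    (hx : ∀ n, DConv Z I (x n) (a n))
    (hxy : ∀ n, ∃ i₀, ∀ i, i₀ ≤ i → |x n i - y i| ≤ w n) : ∃ b, DConv Z I y b := by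
  -- Every left endpoint of the intervals `[a n - w n, a n + w n]` lies below every right one, so
  -- the supremum `b` of the left endpoints belongs to all of them.
  have hcross : ∀ m n, a n - w n ≤ a m + w m := by
    intro m n
    have : |a n - a m| ≤ w n + w m := by
      refine DConv.abs_sub_le hZ (hx n) (hx m) ?_
      obtain ⟨i, hi⟩ := hxy n
      obtain ⟨j, hj⟩ := hxy m
      obtain ⟨k, hik, hjk⟩ := exists_ge_ge i j
      refine ⟨k, fun l hl => ?_⟩
      have e : x n l - x m l = (x n l - y l) + -(x m l - y l) := by abel
      rw [e]
      refine (abs_add_le _ _).trans (add_le_add (hi l (hik.trans hl)) ?_)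
      rw [abs_neg]
      exact hj l (hjk.trans hl)
    have := sub_le_iff_le_add.1 ((le_abs_self _).trans this)
    rw [sub_le_iff_le_add]
    exact this.trans_eq (by abel)
  obtain ⟨b, hb⟩ : ∃ b, IsLUB (range fun n => a n - w n) b :=
    ⟨_, isLUB_csSup (range_nonempty _) ⟨a 0 + w 0, forall_mem_range.2 (hcross 0)⟩⟩
  have hab : ∀ n, |a n - b| ≤ w n := fun n => by
    have h1 := hb.1 (mem_range_self n)
    have h2 : b ≤ a n + w n := hb.2 (forall_mem_range.2 (hcross n))
    refine abs_le'.2 ⟨sub_le_comm.1 h1, ?_⟩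
    rw [neg_sub]
    exact sub_le_iff_le_add'.2 h2
  have hsum : ∀ n i, |y i - b| ≤ |x n i - y i| + |x n i - a n| + |a n - b| := fun n i => by
    have e : y i - b = -(x n i - y i) + (x n i - a n) + (a n - b) := by abel
    rw [e]
    refine (abs_add_le _ _).trans (add_le_add_left ((abs_add_le _ _).trans ?_) _)
    rw [abs_neg]
  -- The bounds of the regulators `c n` may grow with `n`. Cutting at `M` keeps the merged regulator
  -- bounded and costs nothing, since `|y i - b|` is eventually below `M`.
  obtain ⟨M, iM, hM⟩ : ∃ M, ∃ i₀, ∀ i, i₀ ≤ i → |y i - b| ≤ M := by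
    obtain ⟨M, i, hi⟩ := (hx 0).exists_bound
    obtain ⟨j, hj⟩ := hxy 0
    obtain ⟨k, hik, hjk⟩ := exists_ge_ge i j
    exact ⟨w 0 + M + w 0, k, fun l hl => (hsum 0 l).trans
      (add_le_add (add_le_add (hj l (hjk.trans hl)) (hi l (hik.trans hl))) (hab 0))⟩
  have hM0 : 0 ≤ M := (abs_nonneg _).trans (hM iM le_rfl)
  choose c hc hcx using hx
  -- The factors 4 and 2 make both `2 w (φ 0)` and the truncated regulator term at most half of the
  -- supremum `S`.
  let d : ℕ → ℕ → Z := fun k j => Nat.casesOn k ((4 : ℝ) • w j)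
    fun l => (2 : ℝ) • (M ⊓ c l.unpair.1 l.unpair.2 j)
  have hd_succ : ∀ l j, d (l + 1) j = (2 : ℝ) • (M ⊓ c l.unpair.1 l.unpair.2 j) := fun _ _ => rfl
  have hd_bdd : ∀ k j, d k j ≤ (4 : ℝ) • w 0 ⊔ (2 : ℝ) • M := by
    rintro (_ | l) j
    · exact (smul_le_smul_of_nonneg_left (hw.1 (zero_le)) (by norm_num)).trans le_sup_left
    · exact (smul_le_smul_of_nonneg_left inf_le_left (by norm_num)).trans le_sup_right
  refine ⟨b, d, ⟨?_, _, hd_bdd⟩, fun φ => ?_⟩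
  · rintro (_ | l)
    · exact hw.const_smul (by norm_num)
    · exact (((hc l.unpair.1).1 l.unpair.2).const_inf hM0).const_smul (by norm_num)
  obtain ⟨S, hS⟩ : ∃ S, IsLUB (range fun k => d k (φ k)) S :=
    ⟨_, isLUB_csSup (range_nonempty _) ⟨_, forall_mem_range.2 fun k => hd_bdd k (φ k)⟩⟩
  -- `φ 0` selects the approximant; of the remaining rows only those coming from its regulator are
  -- used.
  obtain ⟨s, hs, i, hi⟩ := hcx (φ 0) fun l => φ (Nat.pair (φ 0) l + 1)
  obtain ⟨j, hj⟩ := hxy (φ 0)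
  obtain ⟨m, him, hjm⟩ := exists_ge_ge i j
  obtain ⟨k, hmk, hMk⟩ := exists_ge_ge m iM
  refine ⟨S, hS, k, fun l hl => ?_⟩
  have hmin : M ⊓ s ≤ (2 : ℝ)⁻¹ • S := hs.inf_le_of_forall_inf_le fun l => by
    have := hS.1 (mem_range_self (Nat.pair (φ 0) l + 1))
    simp only [hd_succ, Nat.unpair_pair] at this
    exact (le_inv_smul_iff_of_pos two_pos).2 this
  have hw4 : (2 : ℝ) • w (φ 0) ≤ (2 : ℝ)⁻¹ • S := by
    rw [le_inv_smul_iff_of_pos two_pos, smul_smul]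
    have : (4 : ℝ) • w (φ 0) ≤ S := hS.1 (mem_range_self 0)
    norm_num [this]
  have h1 : |y l - b| - (2 : ℝ) • w (φ 0) ≤ M ⊓ s := by
    refine le_inf ?_ ?_
    · exact (sub_le_self _ (smul_nonneg zero_le_two (hw.nonneg _))).trans (hM l (hMk.trans hl))
    · have h2 := hsum (φ 0) l
      have h3 := hj l (hjm.trans (hmk.trans hl))
      have h4 := hi l (him.trans (hmk.trans hl))
      have h5 := hab (φ 0)
      rw [two_smul]
      rw [sub_le_iff_le_add]
      exact h2.trans ((add_le_add (add_le_add h3 h4) h5).trans_eq (by abel))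
  calc |y l - b| ≤ (2 : ℝ)⁻¹ • S + (2 : ℝ)⁻¹ • S :=
        sub_le_iff_le_add.1 (h1.trans hmin) |>.trans (add_le_add_right hw4 _)
    _ = S := by rw [← add_smul]; norm_num

/-! ### Regular integrators -/

theorem IsBoccutoCandeloro.add_same {Y : Type v} [Lattice Y] [AddCommGroup Y] [Module ℝ Y]
    {η : NetConv.{u} Y} (hη : IsBoccutoCandeloro η) {I : Type u} [Preorder I] [IsDirectedOrder I]
    [Nonempty I] {x y : I → Y} {a b : Y} (hx : η I x a) (hy : η I y b) :
    η I (fun i => x i + y i) (a + b) :=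
  have : IsDirectedOrder (I × I) := ⟨fun p q =>
    let ⟨i, h₁, h₂⟩ := exists_ge_ge p.1 q.1
    let ⟨j, h₃, h₄⟩ := exists_ge_ge p.2 q.2
    ⟨(i, j), ⟨h₁, h₃⟩, ⟨h₂, h₄⟩⟩⟩
  -- The diagonal is a quasi-subnet of the product net.
  hη.quasiSubnet _ _ _ (hη.add x y a b hx hy) fun p =>
    let ⟨k, h₁, h₂⟩ := exists_ge_ge p.1 p.2
    ⟨k, fun j hj => ⟨(j, j), ⟨h₁.trans hj, h₂.trans hj⟩, rfl⟩⟩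

theorem IsBoccutoCandeloro.sum {Y : Type v} [Lattice Y] [AddCommGroup Y] [Module ℝ Y]
    {η : NetConv.{u} Y} (hη : IsBoccutoCandeloro η) {I : Type u} [Preorder I] [IsDirectedOrder I]
    [Nonempty I] {ι : Type*} (F : Finset ι) {x : ι → I → Y} {a : ι → Y}
    (h : ∀ k ∈ F, η I (x k) (a k)) : η I (fun i => ∑ k ∈ F, x k i) (∑ k ∈ F, a k) := by
  classical
  induction F using Finset.induction_on with
  | empty => simpa using hη.const (I := I) (0 : Y)
  | insert k F hk ih =>
    simp only [Finset.sum_insert hk]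
    exact hη.add_same (h k (Finset.mem_insert_self _ _))
      (ih fun l hl => h l (Finset.mem_insert_of_mem hl))

/-- The partition of `Ω` into `N` and its complement. -/
def CountablePartition.ofSet {Ω : Type u} {H : Set (Set Ω)} (hH : MeasureTheory.IsSetAlgebra H)
    {N : Set Ω} (hN : N ∈ H) : CountablePartition H where
  parts := {N, Nᶜ} \ {∅}
  countable := (Set.toFinite _).countable
  subset := by
    rintro σ ⟨rfl | rfl, -⟩
    exacts [hN, hH.compl_mem hN]
  nonempty _ hσ := nonempty_iff_ne_empty.2 hσ.2
  disjoint := by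
    rintro σ ⟨rfl | rfl, -⟩ ρ ⟨rfl | rfl, -⟩ hne
    exacts [(hne rfl).elim, disjoint_compl_right, disjoint_compl_left, (hne rfl).elim]
  cover := by
    refine eq_univ_of_forall fun t => ?_
    by_cases ht : t ∈ N
    · exact ⟨N, ⟨.inl rfl, nonempty_iff_ne_empty.1 ⟨t, ht⟩⟩, ht⟩
    · exact ⟨Nᶜ, ⟨.inr rfl, nonempty_iff_ne_empty.1 ⟨t, ht⟩⟩, ht⟩

/-- An index of the Sion net whose partition is `P` and whose truncation is empty. -/
noncomputable def SionIndex.ofPartition {Ω : Type u} {H : Set (Set Ω)} (P : CountablePartition H) :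
    SionIndex H where
  partition := P
  point σ := (P.nonempty σ.1 σ.2).some
  point_mem σ := (P.nonempty σ.1 σ.2).some_mem
  truncation := ⟨fun _ => ∅, by simp⟩

theorem SionIndex.nonempty {Ω : Type u} {H : Set (Set Ω)} (hH : MeasureTheory.IsSetAlgebra H) :
    Nonempty (SionIndex H) :=
  ⟨.ofPartition (.ofSet hH hH.empty_mem)⟩

/-- A regular integrator with positive values is superadditive and monotone. -/
theorem IsRegularIntegrator.sum_le {Ω : Type u} {Y : Type*} [Lattice Y] [AddCommGroup Y]
    [IsOrderedAddMonoid Y] [Module ℝ Y] [IsOrderedModule ℝ Y] {η : NetConv.{u} Y}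
    (hη : IsBoccutoCandeloro η) {H : Set (Set Ω)} (hH : MeasureTheory.IsSetAlgebra H)
    {μ : Set Ω → Y} (hμ : ∀ A ∈ H, 0 ≤ μ A) (hreg : IsRegularIntegrator H η μ)
    {F : Finset (Set Ω)} (hF : ∀ σ ∈ F, σ ∈ H) (hdisj : (F : Set (Set Ω)).PairwiseDisjoint id)
    {A : Set Ω} (hA : A ∈ H) (hFA : ∀ σ ∈ F, σ ⊆ A) : ∑ σ ∈ F, μ σ ≤ μ A := by
  have := SionIndex.isDirectedOrder hH
  have := SionIndex.nonempty hH
  refine hη.le _ _ _ _ (hη.sum F fun σ hσ => hreg σ (hF σ hσ)) (hreg A hA)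
    fun γ => ⟨γ, le_rfl, ?_⟩
  simp only [SionIndex.riemannSum]
  -- After the exchange, `μ β` has as coefficient the sum of the indicators of the `σ ∈ F` at the
  -- tag of `β`; by disjointness this is the indicator of their union.
  rw [Finset.sum_comm]
  refine Finset.sum_le_sum fun β _ => ?_
  have hβ := hμ β.1 (γ.partition.subset (γ.truncation.mem_parts _ β.1 β.2))
  simp only [LinearMap.lsmul_apply]
  rw [← Finset.sum_smul]
  refine smul_le_smul_of_nonneg_right ?_ hβ
  have e := congrFun (Finset.indicator_biUnion F id (f := fun _ : Ω => (1 : ℝ)) hdisj)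
  simp only [id] at e
  rw [← e]
  exact indicator_le_indicator_of_subset (iUnion₂_subset hFA) (fun _ => zero_le_one) _

/-! ### Riemann sums -/

theorem IsRieszProduct.abs_apply_le {X Y Z : Type*}
    [Lattice X] [AddCommGroup X] [IsOrderedAddMonoid X] [Module ℝ X]
    [Lattice Y] [AddCommGroup Y] [Module ℝ Y]
    [Lattice Z] [AddCommGroup Z] [IsOrderedAddMonoid Z] [Module ℝ Z]
    {η₁ : NetConv.{u} X} {η₂ : NetConv.{u} Y} {η₃ : NetConv.{u} Z}
    {B : X →ₗ[ℝ] Y →ₗ[ℝ] Z} (hB : IsRieszProduct η₁ η₂ η₃ B) {x x' : X} {y : Y}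
    (hy : 0 ≤ y) (hx : |x| ≤ x') : |B x y| ≤ B x' y := by
  -- Isotonicity is available only on the positive cones, hence its use on `x' - z`.
  have key : ∀ z, z ≤ x' → B z y ≤ B x' y := fun z hz => by
    have := hB.isotone 0 (x' - z) y y le_rfl (sub_nonneg.2 hz) hy le_rfl
    simpa using this
  refine abs_le'.2 ⟨key x ((le_abs_self x).trans hx), ?_⟩
  simpa using key (-x) ((neg_le_abs x).trans hx)

theorem abs_sum_le_of_forall_abs_le {Z ι : Type*} [Lattice Z] [AddCommGroup Z]
    [IsOrderedAddMonoid Z] (F : Finset ι) {x y : ι → Z} (h : ∀ i ∈ F, |x i| ≤ y i) :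
    |∑ i ∈ F, x i| ≤ ∑ i ∈ F, y i := by
  refine abs_le'.2 ⟨Finset.sum_le_sum fun i hi => (le_abs_self _).trans (h i hi), ?_⟩
  rw [← Finset.sum_neg_distrib]
  exact Finset.sum_le_sum fun i hi => (neg_le_abs _).trans (h i hi)

/-- If `|f - g| ≤ c` outside a null set, then the Riemann sums of `f` and `g` over sufficiently
fine partitions differ by at most `c μ(Ω)`. -/
theorem SionIndex.abs_riemannSum_sub_le {Ω : Type u} {X Y Z : Type*}
    [Lattice X] [AddCommGroup X] [IsOrderedAddMonoid X] [Module ℝ X]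
    [Lattice Y] [AddCommGroup Y] [IsOrderedAddMonoid Y] [Module ℝ Y] [IsOrderedModule ℝ Y]
    [Lattice Z] [AddCommGroup Z] [IsOrderedAddMonoid Z] [Module ℝ Z]
    {η₁ : NetConv.{u} X} {η₂ : NetConv.{u} Y} {η₃ : NetConv.{u} Z} (hη₂ : IsBoccutoCandeloro η₂)
    {B : X →ₗ[ℝ] Y →ₗ[ℝ] Z} (hB : IsRieszProduct η₁ η₂ η₃ B)
    {H : Set (Set Ω)} (hH : MeasureTheory.IsSetAlgebra H)
    {μ : Set Ω → Y} (hμ : ∀ A ∈ H, 0 ≤ μ A) (hreg : IsRegularIntegrator H η₂ μ)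
    {N : Set Ω} (hN : N ∈ H) (hμN : μ N = 0) {f g : Ω → X} {c : X} (hc : 0 ≤ c)
    (hfg : ∀ t ∉ N, |f t - g t| ≤ c) :
    ∃ γ₀ : SionIndex H, ∀ γ, γ₀ ≤ γ →
      |γ.riemannSum B f μ - γ.riemannSum B g μ| ≤ B c (μ univ) := by
  -- With an empty truncation, lying above this index only means refining `{N, Nᶜ}`.
  refine ⟨.ofPartition (.ofSet hH hN), fun γ hγ => ?_⟩
  set F := γ.truncation.toFun γ.partition
  have hF : ∀ σ ∈ F, σ ∈ γ.partition.parts := γ.truncation.mem_parts _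
  have hFH : ∀ σ ∈ F, σ ∈ H := fun σ hσ => γ.partition.subset (hF σ hσ)
  have hle : ∑ σ ∈ F, μ σ ≤ μ univ :=
    hreg.sum_le hη₂ hH hμ hFH (γ.partition.disjoint.subset hF) hH.univ_mem
      fun σ _ => subset_univ σ
  calc |γ.riemannSum B f μ - γ.riemannSum B g μ| ≤ ∑ σ ∈ F.attach, B c (μ σ.1) := by
        rw [riemannSum, riemannSum, ← Finset.sum_sub_distrib]
        refine abs_sum_le_of_forall_abs_le _ fun σ _ => ?_
        have hσ := hμ σ.1 (hFH σ.1 σ.2)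
        rw [← LinearMap.sub_apply, ← map_sub]
        obtain ⟨α, ⟨rfl | rfl, -⟩, hσα⟩ := hγ.1 σ.1 (hF σ.1 σ.2)
        · have h0 : μ σ.1 = 0 := by
            refine le_antisymm ?_ hσ
            have := hreg.sum_le hη₂ hH hμ (F := {σ.1}) (by simpa using hFH σ.1 σ.2) (by simp) hN
              (by simpa using hσα)
            simpa [hμN] using this
          simp [h0]
        · exact hB.abs_apply_le hσ (hfg _ (hσα (γ.point_mem ⟨σ.1, hF σ.1 σ.2⟩)))
    _ = B c (∑ σ ∈ F, μ σ) := by rw [Finset.sum_attach F fun σ => B c (μ σ), map_sum]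
    _ ≤ B c (μ univ) :=
        hB.isotone c c _ _ hc le_rfl (Finset.sum_nonneg fun σ hσ => hμ σ (hFH σ hσ)) hle

/-! ### The convergence theorem -/

theorem mainTheorem10 {Ω : Type u} {X Y Z : Type*}
    [Lattice X] [AddCommGroup X] [IsOrderedAddMonoid X] [Module ℝ X] [IsOrderedModule ℝ X]
    [Lattice Y] [AddCommGroup Y] [IsOrderedAddMonoid Y] [Module ℝ Y] [IsOrderedModule ℝ Y]
    [ConditionallyCompleteLattice Z] [AddCommGroup Z] [IsOrderedAddMonoid Z] [Module ℝ Z]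
    [IsOrderedModule ℝ Z]
    (hZ : WeaklySigmaDistributive Z)
    (η₁ : NetConv.{u} X) (hη₁ : IsBoccutoCandeloro η₁)
    (hη₁_mono : ∀ u : ℕ → X, DecreasesToZero u → η₁ (ULift.{u} ℕ) (fun n => u n.down) 0)
    (η₂ : NetConv.{u} Y) (hη₂ : IsBoccutoCandeloro η₂)
    (B : X →ₗ[ℝ] Y →ₗ[ℝ] Z) (hB : IsRieszProduct η₁ η₂ (DConv.{u} Z) B)
    (H : Set (Set Ω)) (hH : MeasureTheory.IsSetAlgebra H)
    (μ : Set Ω → Y) (hμ : ∀ A ∈ H, 0 ≤ μ A) (hμ_reg : IsRegularIntegrator H η₂ μ)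
    (f : ℕ → Ω → X) (hf : ∀ n, SionIntegrable H (DConv.{u} Z) B μ (f n))
    (g : Ω → X) (hfg : ConvergesOrderUniformlyAE H μ f g) :
    SionIntegrable H (DConv.{u} Z) B μ g ∧
      ∀ (I : ℕ → Z) (J : Z), (∀ n, HasSionIntegral H (DConv.{u} Z) B μ (f n) (I n)) →
        HasSionIntegral H (DConv.{u} Z) B μ g J → SeqOrderConverges I J := by
  obtain ⟨N, hN, hμN, u, hu, hfgu⟩ := hfg
  have := SionIndex.isDirectedOrder hH
  have hμu := hμ univ hH.univ_mem
  have hw : DecreasesToZero fun n => B (u n) (μ univ) := by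
    refine DConv.decreasesToZero hZ
      (fun m n h => hB.isotone _ _ _ _ (hu.nonneg n) (hu.1 h) hμu le_rfl) (fun n => ?_) ?_
    · simpa using hB.isotone 0 (u n) _ _ le_rfl (hu.nonneg n) hμu le_rfl
    · simpa using hB.continuous_left (μ univ) _ _ (hη₁_mono u hu)
  have happrox := fun n => SionIndex.abs_riemannSum_sub_le hη₂ hB hH hμ hμ_reg hN hμN
    (hu.nonneg n) (hfgu n)
  choose I hI using hf
  exact ⟨DConv.exists_of_uniform_approx hZ hw hI happrox, fun I J hI hJ =>
    ⟨_, hw, fun n => DConv.abs_sub_le hZ (hI n) hJ (happrox n)⟩⟩
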